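/- A quasi-norm on a vector space $X$ over $\mathbb{F}\in\{\mathbb{R},\mathbb{C}\}$ is a map $\|\cdot\|\colon X\to[0,\infty)$ that vanishes only at $0$, is absolutely homogeneous, and satisfies $\|f+g\|\le\kappa(\|f\|+\|g\|)$ for some constant $\kappa\ge 1$; $X$ is a quasi-Banach space if it is complete for the induced vector topology. A countable family $\mathcal{B}=(x_\nu)_{\nu\in N}$ in $X$ is an unconditional basis of $X$ if every $f\in X$ has a unique expansion $f=\sum_{\nu} a_\nu x_\nu$ converging unconditionally; the support of $f$ is $\{\nu: a_\nu\ne 0\}$. For $0<q\le\infty$, $\mathcal{B}$ satisfies an upper (resp. lower) $q$-estimate if there is $C>0$ such that $$\Big\|\sum_{i=1}^m f_i\Big\|\le C\Big(\sum_{i=1}^m\|f_i\|^q\Big)^{1/q}\qquad\Big(\text{resp. } \Big(\sum_{i=1}^m\|f_i\|^q\Big)^{1/q}\le C\Big\|\sum_{i=1}^m f_i\Big\|\Big)$$ for all $m\in\mathbb{N}$ and all $f_1,\dots,f_m\in X$ with pairwise disjoint supports (with the maximum of the $\|f_i\|$ in place of the $\ell_q$-sum if $q=\infty$). Two quasi-Banach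 spaces are totally incomparable if no infinite-dimensional quasi-Banach space is isomorphic both to a subspace of the first and to a subspace of the second. Let $n\in\mathbb{N}$ and let $X_1,\dots,X_n$ be quasi-Banach spaces over $\mathbb{F}$, each $X_j$ having an unconditional basis $\mathcal{B}_j$. Suppose that there are $(q_j)_{j=1}^{n-1}$ and $(r_j)_{j=2}^{n}$ in $(0,\infty]$ such that - $q_j<r_{j+1}$ for all $1\le j\le n-1$; - $\mathcal{B}_j$ satisfies a lower $q_j$-estimate for all $1\le j\le n-1$; - $\mathcal{B}_j$ satisfies an upper $r_j$-estimate for all $2\le j\le n$; - for each $2\le j\le n-1$, $X_j$ is infinite-dimensional or $r_j\le q_j$. Then for every partition $(A,B)$ of $\{1,\dots,n\}$ (one of the parts may be empty), the spaces $\bigoplus_{j\in A}X_j$ and $\bigoplus_{j\in B}X_j$ are totally incomparable. -/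

import Mathlib

open scoped ENNReal Uniformity

universe u v w

/-- `X`, with the given `‖·‖`, is a quasi-Banach space over `𝕜` (`ℝ` or `ℂ`): `‖·‖` is a quasi-norm,
the uniform structure (hence the topology) of `X` is the one given by the sets
`{(f, g) | ‖f - g‖ < ε}`, and `X` is complete. -/
class QuasiBanachSpace (𝕜 : Type*) [RCLike 𝕜] (X : Type*) [AddCommGroup X] [Module 𝕜 X]
    [Norm X] [UniformSpace X] : Prop extends CompleteSpace X where
  norm_nonneg : ∀ f : X, 0 ≤ ‖f‖
  norm_eq_zero_iff : ∀ f : X, ‖f‖ = 0 ↔ f = 0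
  norm_smul : ∀ (a : 𝕜) (f : X), ‖a • f‖ = ‖a‖ * ‖f‖
  exists_norm_add_le : ∃ κ : ℝ, 1 ≤ κ ∧ ∀ f g : X, ‖f + g‖ ≤ κ * (‖f‖ + ‖g‖)
  uniformity_hasBasis :
    (𝓤 X).HasBasis (fun ε : ℝ => 0 < ε) (fun ε => {p : X × X | ‖p.1 - p.2‖ < ε})

/-- The countable family `x` is an unconditional basis of `X`: every vector has a unique expansion
that converges unconditionally. (Then the closed linear span of the family is all of `X`. `HasSum`
is convergence along the net of finite subsets of the index set, i.e. unconditional convergence.) -/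
structure IsUnconditionalBasis (𝕜 : Type*) [RCLike 𝕜] {X : Type*} [AddCommGroup X] [Module 𝕜 X]
    [TopologicalSpace X] {ι : Type*} (x : ι → X) : Prop where
  countable : Countable ι
  existsUnique_hasSum : ∀ f : X, ∃! a : ι → 𝕜, HasSum (fun n => a n • x n) f

/-- The `ℓ_q` quasi-norm, `0 < q ≤ ∞`, of a finite family of nonnegative real numbers. -/
noncomputable def lqSum (q : ℝ≥0∞) {m : ℕ} (c : Fin m → ℝ) : ℝ :=
  if q = ∞ then ⨆ j, c j else (∑ j, c j ^ q.toReal) ^ (1 / q.toReal)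

namespace IsUnconditionalBasis

variable {𝕜 : Type*} [RCLike 𝕜] {X : Type*} [AddCommGroup X] [Module 𝕜 X] [TopologicalSpace X]
  {ι : Type*} {x : ι → X}

/-- The coefficients of `f` with respect to the basis. -/
noncomputable def coeff (hx : IsUnconditionalBasis 𝕜 x) (f : X) : ι → 𝕜 :=
  (hx.existsUnique_hasSum f).choose

/-- The support of `f` with respect to the basis. -/
def supp (hx : IsUnconditionalBasis 𝕜 x) (f : X) : Set ι :=
  {n | hx.coeff f n ≠ 0}

/-- The basis satisfies an upper `q`-estimate. -/
def UpperEstimate [Norm X] (hx : IsUnconditionalBasis 𝕜 x) (q : ℝ≥0∞) : Prop :=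
  ∃ C : ℝ, 0 < C ∧ ∀ (m : ℕ) (f : Fin m → X),
    (Pairwise fun i j => Disjoint (hx.supp (f i)) (hx.supp (f j))) →
      ‖∑ j, f j‖ ≤ C * lqSum q fun j => ‖f j‖

/-- The basis satisfies a lower `q`-estimate. -/
def LowerEstimate [Norm X] (hx : IsUnconditionalBasis 𝕜 x) (q : ℝ≥0∞) : Prop :=
  ∃ C : ℝ, 0 < C ∧ ∀ (m : ℕ) (f : Fin m → X),
    (Pairwise fun i j => Disjoint (hx.supp (f i)) (hx.supp (f j))) →
      lqSum q (fun j => ‖f j‖) ≤ C * ‖∑ j, f j‖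

end IsUnconditionalBasis

/-- `X` and `Y` are totally incomparable: no infinite-dimensional quasi-Banach space `Z` is
isomorphic both to a subspace of `X` and to a subspace of `Y`. Only the linear and topological
structures of `X` and `Y` matter. -/
def TotallyIncomparable (𝕜 : Type*) [RCLike 𝕜]
    (X : Type*) [AddCommGroup X] [Module 𝕜 X] [TopologicalSpace X]
    (Y : Type*) [AddCommGroup Y] [Module 𝕜 Y] [TopologicalSpace Y] : Prop :=
  ¬ ∃ (Z : Type w) (_ : AddCommGroup Z) (_ : Module 𝕜 Z) (_ : Norm Z) (_ : UniformSpace Z),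
    QuasiBanachSpace 𝕜 Z ∧ ¬ FiniteDimensional 𝕜 Z ∧
      (∃ M : Submodule 𝕜 X, Nonempty (Z ≃L[𝕜] M)) ∧
      (∃ N : Submodule 𝕜 Y, Nonempty (Z ≃L[𝕜] N))

/-!
Every infinite-dimensional subspace `W` of `⨁ X_j` contains vectors that concentrate on a single
component `i`. Indeed, let `i` be the least index such that, on some tail subspace of `W`, the
components up to `i` control all the others. Since the components below `i` do not, a gliding hump
produces vectors of `W` which are normalized in `X_i`, summably small below `i`, and close to
vectors with disjoint supports in each `X_j`. By the estimates, as `q_i < r_j` for `i < j`, the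
`i`-th component of their partial sums grows faster than all the other components.

An isomorphism `e` between infinite-dimensional subspaces of `⨁_A X_j` and `⨁_B X_j` gives such a
subspace `W`, consisting of the vectors `z + e z`. If `i ∉ A` then the concentrating vectors have
`z → 0`, and if `i ∉ B` they have `e z → 0`; in both cases `z + e z → 0`, although its `i`-th
component does not tend to `0`.
-/

open Filter Topology Asymptotics

/-- `X`, with the given `‖·‖`, is a quasi-normed space over `𝕜`, not necessarily complete. As for
`QuasiBanachSpace`, the topology is required to be the one induced by the quasi-norm. -/
class QuasiNormedSpace (𝕜 : Type*) [RCLike 𝕜] (X : Type*) [AddCommGroup X] [Module 𝕜 X]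
    [Norm X] [TopologicalSpace X] : Prop where
  norm_nonneg : ∀ f : X, 0 ≤ ‖f‖
  norm_eq_zero_iff : ∀ f : X, ‖f‖ = 0 ↔ f = 0
  norm_smul : ∀ (a : 𝕜) (f : X), ‖a • f‖ = ‖a‖ * ‖f‖
  exists_norm_add_le : ∃ κ : ℝ, 1 ≤ κ ∧ ∀ f g : X, ‖f + g‖ ≤ κ * (‖f‖ + ‖g‖)
  nhds_hasBasis : ∀ f : X, (𝓝 f).HasBasis (fun ε : ℝ => 0 < ε) (fun ε => {g | ‖g - f‖ < ε})

instance QuasiBanachSpace.toQuasiNormedSpace (𝕜 : Type*) [RCLike 𝕜] (X : Type*) [AddCommGroup X]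
    [Module 𝕜 X] [Norm X] [UniformSpace X] [QuasiBanachSpace 𝕜 X] : QuasiNormedSpace 𝕜 X where
  norm_nonneg := norm_nonneg 𝕜
  norm_eq_zero_iff := norm_eq_zero_iff 𝕜
  norm_smul := norm_smul
  exists_norm_add_le := exists_norm_add_le 𝕜
  nhds_hasBasis f := by simpa using nhds_basis_uniformity (uniformity_hasBasis (𝕜 := 𝕜)) (x := f)

namespace QuasiNormedSpace

section

variable (𝕜 : Type*) [RCLike 𝕜] {X : Type*} [AddCommGroup X] [Module 𝕜 X] [Norm X]
  [TopologicalSpace X] [QuasiNormedSpace 𝕜 X]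

include 𝕜

theorem norm_zero : ‖(0 : X)‖ = 0 := (norm_eq_zero_iff 𝕜 0).2 rfl

theorem norm_pos {f : X} (hf : f ≠ 0) : 0 < ‖f‖ :=
  (norm_nonneg 𝕜 f).lt_of_ne' fun h => hf ((norm_eq_zero_iff 𝕜 f).1 h)

theorem norm_sub_comm (f g : X) : ‖f - g‖ = ‖g - f‖ := by
  simpa using norm_smul (-1 : 𝕜) (g - f)

theorem norm_inv_norm_smul {Y : Type*} [AddCommGroup Y] [Module 𝕜 Y] [Norm Y]
    [TopologicalSpace Y] [QuasiNormedSpace 𝕜 Y] (f : X) (g : Y) :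
    ‖((‖f‖⁻¹ : ℝ) : 𝕜) • g‖ = ‖g‖ / ‖f‖ := by
  rw [norm_smul, RCLike.norm_ofReal, abs_of_nonneg (inv_nonneg.2 (norm_nonneg 𝕜 f)),
    div_eq_inv_mul]

theorem tendsto_nhds_iff {α : Type*} {l : Filter α} {u : α → X} {f : X} :
    Tendsto u l (𝓝 f) ↔ Tendsto (fun a => ‖u a - f‖) l (𝓝 0) := by
  rw [(nhds_hasBasis 𝕜 f).tendsto_right_iff, Metric.tendsto_nhds]
  simp [abs_of_nonneg (norm_nonneg 𝕜 _)]

theorem continuousAdd : ContinuousAdd X := by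
  obtain ⟨κ, -, hadd⟩ := exists_norm_add_le 𝕜 (X := X)
  refine ⟨continuous_iff_continuousAt.2 fun p => (tendsto_nhds_iff 𝕜).2 ?_⟩
  have hfst := (tendsto_nhds_iff 𝕜).1 (continuous_fst.tendsto p)
  have hsnd := (tendsto_nhds_iff 𝕜).1 (continuous_snd.tendsto p)
  refine squeeze_zero (fun _ => norm_nonneg 𝕜 _) (fun a => ?_)
    (by simpa using (hfst.add hsnd).const_mul κ)
  rw [add_sub_add_comm]
  exact hadd _ _

instance continuousConstSMul : ContinuousConstSMul 𝕜 X where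
  continuous_const_smul c := continuous_iff_continuousAt.2 fun f => (tendsto_nhds_iff 𝕜).2 <| by
    simpa [← smul_sub, norm_smul] using
      ((tendsto_nhds_iff 𝕜).1 (continuous_id.tendsto f)).const_mul ‖c‖

theorem t2Space : T2Space X := by
  have := continuousAdd 𝕜 (X := X)
  have := ContinuousNeg.of_continuousConstSMul 𝕜 X
  have : IsTopologicalAddGroup X := {}
  refine IsTopologicalAddGroup.t2Space_of_zero_sep fun f hf =>
    ⟨_, (nhds_hasBasis 𝕜 0).mem_of_mem (norm_pos 𝕜 hf), ?_⟩
  simp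

theorem norm_sum_le_of_norm_le_geometric {κ : ℝ} (hκ : 1 ≤ κ)
    (hadd : ∀ f g : X, ‖f + g‖ ≤ κ * (‖f‖ + ‖g‖)) {ε : ℝ} (hε : 0 ≤ ε) {u : ℕ → X}
    (hu : ∀ k, ‖u k‖ ≤ ε / (2 * κ) ^ (k + 1)) (m : ℕ) :
    ‖∑ k ∈ Finset.range m, u k‖ ≤ ε := by
  have : 0 < κ := one_pos.trans_le hκ
  induction m generalizing u ε with
  | zero => simpa [norm_zero 𝕜] using hε
  | succ m ih =>
    have htail : ‖∑ k ∈ Finset.range m, u (k + 1)‖ ≤ ε / (2 * κ) :=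
      ih (by positivity) fun k => (hu (k + 1)).trans_eq (by rw [pow_succ' _ (k + 1), div_div])
    rw [Finset.sum_range_succ']
    calc ‖∑ k ∈ Finset.range m, u (k + 1) + u 0‖
        ≤ κ * (‖∑ k ∈ Finset.range m, u (k + 1)‖ + ‖u 0‖) := hadd _ _
      _ ≤ κ * (ε / (2 * κ) + ε / (2 * κ)) := by
        gcongr
        simpa using hu 0
      _ = ε := by field_simp; ring

theorem isBigO_one_add_norm_of_norm_sub_le {α : Type*} {l : Filter α} {u v : α → X} {C : ℝ}
    (h : ∀ a, ‖u a - v a‖ ≤ C) : (fun a => ‖u a‖) =O[l] fun a => 1 + ‖v a‖ := by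
  obtain ⟨κ, hκ, hadd⟩ := exists_norm_add_le 𝕜 (X := X)
  refine IsBigO.of_bound (κ * max C 1) (Eventually.of_forall fun a => ?_)
  have hv := norm_nonneg 𝕜 (v a)
  rw [Real.norm_of_nonneg (norm_nonneg 𝕜 _), Real.norm_of_nonneg (by positivity)]
  calc ‖u a‖ = ‖u a - v a + v a‖ := by rw [sub_add_cancel]
    _ ≤ κ * (‖u a - v a‖ + ‖v a‖) := hadd _ _
    _ ≤ κ * (max C 1 * 1 + max C 1 * ‖v a‖) := by
      gcongr
      · exact (h a).trans (by simp)
      · exact le_mul_of_one_le_left hv (le_max_right _ _)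
    _ = κ * max C 1 * (1 + ‖v a‖) := by ring

end

theorem exists_common_norm_add_le (𝕜 : Type*) [RCLike 𝕜] {J : Type*} [Finite J] (X : J → Type*)
    [∀ j, AddCommGroup (X j)] [∀ j, Module 𝕜 (X j)] [∀ j, Norm (X j)]
    [∀ j, TopologicalSpace (X j)] [∀ j, QuasiNormedSpace 𝕜 (X j)] :
    ∃ κ : ℝ, 1 ≤ κ ∧ ∀ j, ∀ f g : X j, ‖f + g‖ ≤ κ * (‖f‖ + ‖g‖) := by
  choose κ _ hadd using fun j => exists_norm_add_le 𝕜 (X := X j)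
  obtain ⟨M, hM⟩ := (Set.finite_range κ).bddAbove
  refine ⟨max M 1, le_max_right _ _, fun j f g => (hadd j f g).trans ?_⟩
  exact mul_le_mul_of_nonneg_right ((hM ⟨j, rfl⟩).trans (le_max_left _ _)) <|
    add_nonneg (norm_nonneg 𝕜 f) (norm_nonneg 𝕜 g)

end QuasiNormedSpace

section lqSum

theorem lqSum_mono (q : ℝ≥0∞) {m : ℕ} {a b : Fin m → ℝ} (ha : 0 ≤ a) (hab : a ≤ b) :
    lqSum q a ≤ lqSum q b := by
  rw [lqSum, lqSum]
  split_ifs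
  · exact ciSup_mono (Set.finite_range b).bddAbove hab
  · exact Real.rpow_le_rpow (Finset.sum_nonneg fun j _ => Real.rpow_nonneg (ha j) _)
      (Finset.sum_le_sum fun j _ => Real.rpow_le_rpow (ha j) (hab j) ENNReal.toReal_nonneg)
      (by positivity)

-- For `q = ∞` the formula holds because `⊤.toReal = 0` and `1 / 0 = 0`.
theorem lqSum_const {q : ℝ≥0∞} (hq : 0 < q) {m : ℕ} [NeZero m] {c : ℝ} (hc : 0 ≤ c) :
    lqSum q (fun _ : Fin m => c) = c * (m : ℝ) ^ (1 / q.toReal) := by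
  rw [lqSum]
  split_ifs with hq'
  · simp [hq']
  · have hq0 : q.toReal ≠ 0 := (ENNReal.toReal_pos hq.ne' hq').ne'
    rw [Finset.sum_const, Finset.card_univ, Fintype.card_fin, nsmul_eq_mul,
      Real.mul_rpow (by positivity) (by positivity), ← Real.rpow_mul hc, mul_one_div_cancel hq0,
      Real.rpow_one, mul_comm]

theorem one_div_toReal_lt {q r : ℝ≥0∞} (hq : 0 < q) (hqr : q < r) :
    1 / r.toReal < 1 / q.toReal := by
  simpa using ENNReal.toReal_strict_mono (ENNReal.inv_ne_top.2 hq.ne') (ENNReal.inv_lt_inv.2 hqr)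

theorem isLittleO_natCast_rpow_rpow {s t : ℝ} (hst : s < t) :
    (fun m : ℕ => (m : ℝ) ^ s) =o[atTop] fun m : ℕ => (m : ℝ) ^ t := by
  refine isLittleO_of_tendsto' ?_ ?_
  · filter_upwards [eventually_gt_atTop 0] with m hm h
    exact absurd h (by positivity)
  · refine ((tendsto_rpow_neg_atTop (sub_pos.2 hst)).comp tendsto_natCast_atTop_atTop).congr' ?_
    filter_upwards [eventually_gt_atTop 0] with m hm
    rw [Function.comp_apply, neg_sub, Real.rpow_sub (by positivity)]

end lqSum

namespace IsUnconditionalBasis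

variable {𝕜 : Type*} [RCLike 𝕜] {X : Type*} [AddCommGroup X] [Module 𝕜 X] {ι : Type*} {x : ι → X}

section Coefficients

variable [TopologicalSpace X] (hx : IsUnconditionalBasis 𝕜 x)

include hx

theorem hasSum_coeff (f : X) : HasSum (fun ν => hx.coeff f ν • x ν) f :=
  (hx.existsUnique_hasSum f).choose_spec.1

theorem coeff_eq {f : X} {a : ι → 𝕜} (h : HasSum (fun ν => a ν • x ν) f) : hx.coeff f = a :=
  (hx.existsUnique_hasSum f).unique (hx.hasSum_coeff f) h

theorem coeff_add [ContinuousAdd X] (f g : X) : hx.coeff (f + g) = hx.coeff f + hx.coeff g :=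
  hx.coeff_eq <| by simpa [add_smul] using (hx.hasSum_coeff f).add (hx.hasSum_coeff g)

theorem coeff_smul [ContinuousConstSMul 𝕜 X] (c : 𝕜) (f : X) :
    hx.coeff (c • f) = c • hx.coeff f :=
  hx.coeff_eq <| by simpa [smul_smul] using (hx.hasSum_coeff f).const_smul c

theorem coeff_sum_smul (a : ι → 𝕜) (s : Finset ι) :
    hx.coeff (∑ ν ∈ s, a ν • x ν) = (s : Set ι).indicator a := by
  refine hx.coeff_eq ?_
  rw [Finset.sum_congr rfl fun ν hν => by rw [← Set.indicator_of_mem (Finset.mem_coe.2 hν) a]]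
  exact hasSum_sum_of_ne_finset_zero fun ν hν => by
    rw [Set.indicator_of_notMem (Finset.mem_coe.not.2 hν), zero_smul]

theorem coeff_smul_basis (c : 𝕜) (ν : ι) :
    hx.coeff (c • x ν) = ({ν} : Set ι).indicator fun _ => c := by
  simpa using hx.coeff_sum_smul (fun _ => c) {ν}

theorem supp_smul_basis_subset (c : 𝕜) (ν : ι) : hx.supp (c • x ν) ⊆ {ν} := by
  rw [supp, hx.coeff_smul_basis]
  exact Set.support_indicator_subset

theorem basis_ne_zero (ν : ι) : x ν ≠ 0 := fun h => by
  have hcoeff : hx.coeff ((1 : 𝕜) • x ν) = hx.coeff ((0 : 𝕜) • x ν) := by simp [h]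
  rw [coeff_smul_basis, coeff_smul_basis] at hcoeff
  simpa using congrFun hcoeff ν

theorem infinite_index [T2Space X] (hX : ¬ FiniteDimensional 𝕜 X) : Infinite ι := by
  by_contra hι
  have := not_infinite_iff_finite.1 hι
  have := Fintype.ofFinite ι
  refine hX (Module.Finite.of_surjective (Fintype.linearCombination 𝕜 x) fun f =>
    ⟨hx.coeff f, ?_⟩)
  rw [Fintype.linearCombination_apply]
  exact (hasSum_fintype _).unique (hx.hasSum_coeff f)

end Coefficients

/-- The vectors `f k` have pairwise disjoint supports with respect to the basis. -/
def DisjointlySupported [TopologicalSpace X] (hx : IsUnconditionalBasis 𝕜 x) (f : ℕ → X) : Prop :=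
  Pairwise fun k l => Disjoint (hx.supp (f k)) (hx.supp (f l))

/-- The basis satisfies a lower `q`-estimate and the other basis satisfies an upper `r`-estimate
for some `q < r`, so that sums of disjointly supported vectors grow faster in the first space. -/
def Dominates [TopologicalSpace X] [Norm X] {Y : Type*} [AddCommGroup Y] [Module 𝕜 Y]
    [TopologicalSpace Y] [Norm Y] {ι' : Type*} {y : ι' → Y}
    (hx : IsUnconditionalBasis 𝕜 x) (hy : IsUnconditionalBasis 𝕜 y) : Prop :=
  ∃ q r : ℝ≥0∞, 0 < q ∧ q < r ∧ hx.LowerEstimate q ∧ hy.UpperEstimate r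

section Estimates

open QuasiNormedSpace

variable [Norm X] [TopologicalSpace X] [QuasiNormedSpace 𝕜 X] {hx : IsUnconditionalBasis 𝕜 x}
  {Y : Type*} [AddCommGroup Y] [Module 𝕜 Y] [Norm Y] [TopologicalSpace Y]
  {ι' : Type*} {y : ι' → Y} {hy : IsUnconditionalBasis 𝕜 y}

theorem UpperEstimate.norm_sum_isBigO_rpow {r : ℝ≥0∞} (hu : hx.UpperEstimate r) (hr : 0 < r)
    {f : ℕ → X} (hf : hx.DisjointlySupported f) {D : ℝ} (hfD : ∀ k, ‖f k‖ ≤ D) :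
    (fun m => ‖∑ k ∈ Finset.range m, f k‖) =O[atTop] fun m => (m : ℝ) ^ (1 / r.toReal) := by
  obtain ⟨C, hC, hu⟩ := hu
  refine IsBigO.of_bound (C * D) ((eventually_ne_atTop 0).mono fun m hm => ?_)
  have : NeZero m := ⟨hm⟩
  have hnonneg : 0 ≤ fun k : Fin m => ‖f k‖ := fun k => QuasiNormedSpace.norm_nonneg 𝕜 (f k)
  rw [Real.norm_of_nonneg (QuasiNormedSpace.norm_nonneg 𝕜 _), Real.norm_of_nonneg (by positivity)]
  calc ‖∑ k ∈ Finset.range m, f k‖ = ‖∑ k : Fin m, f k‖ := by rw [Fin.sum_univ_eq_sum_range]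
    _ ≤ C * lqSum r fun k : Fin m => ‖f k‖ := hu m _ (hf.comp_of_injective Fin.val_injective)
    _ ≤ C * lqSum r fun _ : Fin m => D := by
      gcongr
      exact lqSum_mono r hnonneg fun k => hfD k
    _ = C * D * (m : ℝ) ^ (1 / r.toReal) := by
      rw [lqSum_const hr ((hnonneg 0).trans (hfD _)), mul_assoc]

theorem LowerEstimate.rpow_isBigO_norm_sum {q : ℝ≥0∞} (hl : hx.LowerEstimate q) (hq : 0 < q)
    {f : ℕ → X} (hf : hx.DisjointlySupported f) {c : ℝ} (hc : 0 < c) (hcf : ∀ k, c ≤ ‖f k‖) :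
    (fun m : ℕ => (m : ℝ) ^ (1 / q.toReal)) =O[atTop] fun m => ‖∑ k ∈ Finset.range m, f k‖ := by
  obtain ⟨C, -, hl⟩ := hl
  refine IsBigO.of_bound (C / c) ((eventually_ne_atTop 0).mono fun m hm => ?_)
  have : NeZero m := ⟨hm⟩
  rw [Real.norm_of_nonneg (QuasiNormedSpace.norm_nonneg 𝕜 _), Real.norm_of_nonneg (by positivity),
    div_mul_eq_mul_div, le_div_iff₀' hc]
  calc c * (m : ℝ) ^ (1 / q.toReal) = lqSum q fun _ : Fin m => c := (lqSum_const hq hc.le).symm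
    _ ≤ lqSum q fun k : Fin m => ‖f k‖ := lqSum_mono q (fun _ => hc.le) fun k => hcf k
    _ ≤ C * ‖∑ k : Fin m, f k‖ := hl m _ (hf.comp_of_injective Fin.val_injective)
    _ = C * ‖∑ k ∈ Finset.range m, f k‖ := by rw [Fin.sum_univ_eq_sum_range]

theorem Dominates.norm_sum_isLittleO_norm_sum [QuasiNormedSpace 𝕜 Y] (h : hx.Dominates hy)
    {f : ℕ → X} {g : ℕ → Y} (hf : hx.DisjointlySupported f) (hg : hy.DisjointlySupported g)
    {c D : ℝ} (hc : 0 < c) (hcf : ∀ k, c ≤ ‖f k‖) (hgD : ∀ k, ‖g k‖ ≤ D) :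
    (fun m => ‖∑ k ∈ Finset.range m, g k‖) =o[atTop]
      fun m => ‖∑ k ∈ Finset.range m, f k‖ := by
  obtain ⟨q, r, hq, hqr, hl, hu⟩ := h
  exact ((hu.norm_sum_isBigO_rpow (hq.trans hqr) hg hgD).trans_isLittleO
    (isLittleO_natCast_rpow_rpow (one_div_toReal_lt hq hqr))).trans_isBigO
    (hl.rpow_isBigO_norm_sum hq hf hc hcf)

theorem Dominates.one_isLittleO_norm_sum (h : hx.Dominates hy) {f : ℕ → X}
    (hf : hx.DisjointlySupported f) {c : ℝ} (hc : 0 < c) (hcf : ∀ k, c ≤ ‖f k‖) :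
    (fun _ => (1 : ℝ)) =o[atTop] fun m => ‖∑ k ∈ Finset.range m, f k‖ := by
  obtain ⟨q, r, hq, hqr, hl, -⟩ := h
  have hgrow : (fun m : ℕ => (m : ℝ) ^ (0 : ℝ)) =o[atTop] fun m => (m : ℝ) ^ (1 / q.toReal) :=
    isLittleO_natCast_rpow_rpow (one_div_pos.2 (ENNReal.toReal_pos hq.ne' hqr.ne_top))
  simpa using hgrow.trans_isBigO (hl.rpow_isBigO_norm_sum hq hf hc hcf)

theorem not_dominates_self (hx : IsUnconditionalBasis 𝕜 x) (hX : ¬ FiniteDimensional 𝕜 X) :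
    ¬ hx.Dominates hx := fun h => by
  have := t2Space 𝕜 (X := X)
  have := hx.infinite_index hX
  let e := Infinite.natEmbedding ι
  let f : ℕ → X := fun k => ((‖x (e k)‖⁻¹ : ℝ) : 𝕜) • x (e k)
  have hf_norm (k : ℕ) : ‖f k‖ = 1 := by
    rw [norm_inv_norm_smul, div_self (norm_pos 𝕜 (hx.basis_ne_zero (e k))).ne']
  have hf : hx.DisjointlySupported f := fun k l hkl =>
    (Set.disjoint_singleton.2 (e.injective.ne hkl)).mono
      (hx.supp_smul_basis_subset _ _) (hx.supp_smul_basis_subset _ _)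
  have h_one := h.one_isLittleO_norm_sum hf one_pos fun k => (hf_norm k).ge
  have h_self := h.norm_sum_isLittleO_norm_sum hf hf one_pos
    (fun k => (hf_norm k).ge) fun k => (hf_norm k).le
  have h_ne : ∀ᶠ m in atTop, ‖∑ k ∈ Finset.range m, f k‖ ≠ 0 :=
    h_one.isBigO.eq_zero_imp.mono fun m hm h0 => one_ne_zero (hm h0)
  exact isLittleO_irrefl h_ne.frequently h_self

theorem exists_finite_approx (hx : IsUnconditionalBasis 𝕜 x) (f : X) {ε : ℝ} (hε : 0 < ε) :
    ∃ (g : X) (s : Finset ι), ‖f - g‖ < ε ∧ hx.supp g ⊆ s ∧ hx.supp g ⊆ hx.supp f := by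
  obtain ⟨s, hs⟩ := ((hx.hasSum_coeff f).eventually
    ((nhds_hasBasis 𝕜 f).mem_of_mem hε)).exists
  refine ⟨∑ ν ∈ s, hx.coeff f ν • x ν, s, by rwa [norm_sub_comm 𝕜], ?_⟩
  rw [supp, hx.coeff_sum_smul]
  exact Set.subset_inter_iff.1 (Set.support_indicator (f := hx.coeff f)).subset

end Estimates

end IsUnconditionalBasis

theorem exists_Iic_and_not_Iio {J : Type*} [LinearOrder J] [Finite J] {P : Set J → Prop}
    (hP : Monotone P) (h_empty : ¬ P ∅) (h_univ : P Set.univ) :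
    ∃ i, P (Set.Iic i) ∧ ¬ P (Set.Iio i) := by
  have exists_mem_Iic {S : Set J} (hS : P S) : ∃ l ∈ S, P (Set.Iic l) := by
    have hne : S.Nonempty := Set.nonempty_iff_ne_empty.2 fun h => h_empty (h ▸ hS)
    obtain ⟨l, hl, hmax⟩ := Set.exists_max_image S id S.toFinite hne
    exact ⟨l, hl, hP hmax hS⟩
  obtain ⟨l, -, hl⟩ := exists_mem_Iic h_univ
  obtain ⟨i, hi, hmin⟩ := wellFounded_lt.has_min {i | P (Set.Iic i)} ⟨l, hl⟩
  refine ⟨i, hi, fun h => ?_⟩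
  obtain ⟨l, hli, hl⟩ := exists_mem_Iic h
  exact hmin l hl hli

section DirectSum

open QuasiNormedSpace

variable {𝕜 : Type*} [RCLike 𝕜] {J : Type*} {X : J → Type*}
  [∀ j, AddCommGroup (X j)] [∀ j, Module 𝕜 (X j)] [∀ j, Norm (X j)] [∀ j, TopologicalSpace (X j)]
  [∀ j, QuasiNormedSpace 𝕜 (X j)] {ι : J → Type*} {x : (j : J) → ι j → X j}
  {hx : ∀ j, IsUnconditionalBasis 𝕜 (x j)} {W : Submodule 𝕜 (∀ j, X j)}

/-- The coefficients of a vector of the direct sum at the positions in `F`. The kernels of these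
maps play the role of the tail subspaces of the direct sum. -/
noncomputable def coeffOn (hx : ∀ j, IsUnconditionalBasis 𝕜 (x j)) (F : Finset (Σ j, ι j)) :
    (∀ j, X j) →ₗ[𝕜] F → 𝕜 where
  toFun w p := (hx p.1.1).coeff (w p.1.1) p.1.2
  map_add' w w' := by
    have := fun j => continuousAdd 𝕜 (X := X j)
    ext p
    simp [IsUnconditionalBasis.coeff_add]
  map_smul' c w := by
    ext p
    simp [IsUnconditionalBasis.coeff_smul]

theorem coeffOn_eq_zero_iff {F : Finset (Σ j, ι j)} {w : ∀ j, X j} :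
    coeffOn hx F w = 0 ↔ ∀ p ∈ F, (hx p.1).coeff (w p.1) p.2 = 0 := by
  simp [funext_iff, coeffOn]

theorem coeffOn_eq_zero_of_subset {F F' : Finset (Σ j, ι j)} (hF : F ⊆ F') {w : ∀ j, X j}
    (hw : coeffOn hx F' w = 0) : coeffOn hx F w = 0 :=
  coeffOn_eq_zero_iff.2 fun p hp => coeffOn_eq_zero_iff.1 hw p (hF hp)

theorem exists_mem_ne_zero_coeffOn_eq_zero (hW : ¬ FiniteDimensional 𝕜 W)
    (F : Finset (Σ j, ι j)) : ∃ w ∈ W, w ≠ 0 ∧ coeffOn hx F w = 0 := by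
  have h_not_inj : ¬ Function.Injective ((coeffOn hx F).domRestrict W) :=
    fun h => hW (FiniteDimensional.of_injective _ h)
  rw [LinearMap.injective_domRestrict_iff, disjoint_iff] at h_not_inj
  obtain ⟨w, ⟨hw, hker⟩, hw0⟩ := Submodule.exists_mem_ne_zero_of_ne_bot h_not_inj
  exact ⟨w, hw, hw0, hker⟩

theorem exists_hump [Finite J] {w : ∀ j, X j} {F : Finset (Σ j, ι j)} (hw : coeffOn hx F w = 0)
    {ε : ℝ} (hε : 0 < ε) :
    ∃ (y : ∀ j, X j) (F' : Finset (Σ j, ι j)), F ⊆ F' ∧ (∀ j, ‖w j - y j‖ < ε) ∧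
      ∀ j, ∀ ν ∈ (hx j).supp (y j), (⟨j, ν⟩ : Σ j, ι j) ∈ F' ∧ (⟨j, ν⟩ : Σ j, ι j) ∉ F := by
  classical
  have := Fintype.ofFinite J
  choose y s hy hys hyw using fun j => (hx j).exists_finite_approx (w j) hε
  refine ⟨y, F ∪ Finset.univ.sigma s, Finset.subset_union_left, hy,
    fun j ν hν => ⟨?_, fun hF => ?_⟩⟩
  · exact Finset.mem_union_right _ (Finset.mem_sigma.2 ⟨Finset.mem_univ j, hys j hν⟩)
  · exact hyw j hν (coeffOn_eq_zero_iff.1 hw _ hF)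

theorem exists_gliding_hump [Finite J] {ε : ℕ → ℝ} (hε : ∀ k, 0 < ε k)
    {P : ℕ → (∀ j, X j) → Prop} (hP : ∀ k F, ∃ w, coeffOn hx F w = 0 ∧ P k w) :
    ∃ w y : ℕ → ∀ j, X j, (∀ k, P k (w k)) ∧ (∀ k j, ‖w k j - y k j‖ < ε k) ∧
      ∀ j, (hx j).DisjointlySupported fun k => y k j := by
  choose w hw hPw using hP
  choose y F' hF' hwy hy using fun k F => exists_hump (hw k F) (hε k)
  let F : ℕ → Finset (Σ j, ι j) := fun k => Nat.rec ∅ F' k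
  have hF_mono : Monotone F := monotone_nat_of_le_succ fun k => hF' k (F k)
  refine ⟨fun k => w k (F k), fun k => y k (F k), fun k => hPw k (F k), fun k => hwy k (F k),
    fun j => pairwise_disjoint_on _ |>.2 fun k l hkl => ?_⟩
  exact Set.disjoint_left.2 fun ν hk hl =>
    (hy l (F l) j ν hl).2 (hF_mono (Nat.succ_le_of_lt hkl) (hy k (F k) j ν hk).1)

/-- On some tail subspace of `W`, all components are controlled by those with index in `S`. -/
def IsNorming (hx : ∀ j, IsUnconditionalBasis 𝕜 (x j)) (W : Submodule 𝕜 (∀ j, X j)) (S : Set J) :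
    Prop :=
  ∃ (D : ℝ) (F : Finset (Σ j, ι j)), ∀ w ∈ W, coeffOn hx F w = 0 → ∀ t ≥ 0,
    (∀ l ∈ S, ‖w l‖ ≤ t) → ∀ j, ‖w j‖ ≤ D * t

variable (hx W) in
theorem isNorming_univ : IsNorming hx W Set.univ :=
  ⟨1, ∅, fun _ _ _ t _ h j => (h j trivial).trans_eq (one_mul t).symm⟩

variable (hx W) in
theorem monotone_isNorming : Monotone (IsNorming hx W) := fun _ _ hS ⟨D, F, h⟩ =>
  ⟨D, F, fun w hw hF t ht hwt => h w hw hF t ht fun l hl => hwt l (hS hl)⟩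

variable (hx) in
theorem not_isNorming_empty (hW : ¬ FiniteDimensional 𝕜 W) : ¬ IsNorming hx W ∅ := by
  rintro ⟨D, F, h⟩
  obtain ⟨w, hwW, hw0, hwF⟩ := exists_mem_ne_zero_coeffOn_eq_zero (hx := hx) hW F
  refine hw0 (funext fun j => (norm_eq_zero_iff 𝕜 (w j)).1 (le_antisymm ?_ (norm_nonneg 𝕜 _)))
  simpa using h w hwW hwF 0 le_rfl (by simp) j

/-- Every tail subspace of `W` contains vectors, bounded uniformly over the tail subspaces, whose
`i`-th component is normalized and whose components below `i` are arbitrarily small. -/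
def IsCriticalIndex [LT J] (hx : ∀ j, IsUnconditionalBasis 𝕜 (x j))
    (W : Submodule 𝕜 (∀ j, X j)) (i : J) : Prop :=
  ∃ D : ℝ, ∀ ε > 0, ∀ F : Finset (Σ j, ι j), ∃ w ∈ W, coeffOn hx F w = 0 ∧ ‖w i‖ = 1 ∧
    (∀ j < i, ‖w j‖ ≤ ε) ∧ ∀ j, ‖w j‖ ≤ D

theorem isCriticalIndex_of_isNorming_Iic [PartialOrder J] {i : J}
    (h_Iic : IsNorming hx W (Set.Iic i)) (h_Iio : ¬ IsNorming hx W (Set.Iio i)) :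
    IsCriticalIndex hx W i := by
  classical
  obtain ⟨D, F₀, hD⟩ := h_Iic
  refine ⟨D, fun ε hε F => ?_⟩
  set δ := min ε 1
  have hδ : 0 < δ := lt_min hε one_pos
  simp only [IsNorming] at h_Iio
  push Not at h_Iio
  obtain ⟨w, hwW, hwF, t, ht, hwt, j, hj⟩ := h_Iio (D / δ) (F ∪ F₀)
  replace hD := hD w hwW (coeffOn_eq_zero_of_subset Finset.subset_union_right hwF)
  -- Otherwise `w` would obey the bound that it was chosen to violate.
  have h_large : t / δ < ‖w i‖ := by
    by_contra! hi
    refine hj.not_ge ((hD (t / δ) (by positivity) (fun l hl => ?_) j).trans_eq (by ring))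
    rcases (Set.mem_Iic.1 hl).lt_or_eq with hl | rfl
    · exact (hwt l hl).trans (le_div_self ht hδ (min_le_right _ _))
    · exact hi
  have hpos : 0 < ‖w i‖ := (by positivity : 0 ≤ t / δ).trans_lt h_large
  have ht_le : t ≤ δ * ‖w i‖ := ((div_lt_iff₀' hδ).1 h_large).le
  refine ⟨((‖w i‖⁻¹ : ℝ) : 𝕜) • w, W.smul_mem _ hwW, ?_, ?_, fun l hl => ?_, fun l => ?_⟩
  · rw [map_smul, coeffOn_eq_zero_of_subset Finset.subset_union_left hwF, smul_zero]
  · rw [Pi.smul_apply, norm_inv_norm_smul, div_self hpos.ne']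
  · rw [Pi.smul_apply, norm_inv_norm_smul, div_le_iff₀ hpos]
    calc ‖w l‖ ≤ δ * ‖w i‖ := (hwt l hl).trans ht_le
      _ ≤ ε * ‖w i‖ := by gcongr; exact min_le_left _ _
  · rw [Pi.smul_apply, norm_inv_norm_smul, div_le_iff₀ hpos]
    refine hD ‖w i‖ hpos.le (fun l hl => ?_) l
    rcases (Set.mem_Iic.1 hl).lt_or_eq with hl | rfl
    · exact (hwt l hl).trans (ht_le.trans (mul_le_of_le_one_left hpos.le (min_le_right _ _)))
    · exact le_rfl

variable (hx) in
theorem exists_isCriticalIndex [LinearOrder J] [Finite J] (hW : ¬ FiniteDimensional 𝕜 W) :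
    ∃ i, IsCriticalIndex hx W i := by
  obtain ⟨i, h_Iic, h_Iio⟩ := exists_Iic_and_not_Iio (monotone_isNorming hx W)
    (not_isNorming_empty hx hW) (isNorming_univ hx W)
  exact ⟨i, isCriticalIndex_of_isNorming_Iic h_Iic h_Iio⟩

theorem IsCriticalIndex.exists_disjointlySupported [LT J] [Finite J] {i : J}
    (hi : IsCriticalIndex hx W i) :
    ∃ w y : ℕ → ∀ j, X j, (∀ k, w k ∈ W) ∧ (∀ j, (hx j).DisjointlySupported fun k => y k j) ∧
      (∃ c > 0, ∀ k, c ≤ ‖y k i‖) ∧ (∃ D, ∀ k j, ‖y k j‖ ≤ D) ∧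
      (∀ m j, ‖∑ k ∈ Finset.range m, w k j - ∑ k ∈ Finset.range m, y k j‖ ≤ 1) ∧
      ∀ m, ∀ j < i, ‖∑ k ∈ Finset.range m, w k j‖ ≤ 1 := by
  obtain ⟨D, hD⟩ := hi
  obtain ⟨κ, hκ, hadd⟩ := exists_common_norm_add_le 𝕜 X
  have hκ0 : 0 < κ := one_pos.trans_le hκ
  let η : ℝ := 1 / (2 * κ)
  have hη : 0 < η := by positivity
  have hη_one : η ≤ 1 := (div_le_one (by positivity)).2 (by linarith)
  let ε : ℕ → ℝ := fun k => η / (2 * κ) ^ (k + 1)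
  have hε (k : ℕ) : 0 < ε k := by positivity
  have hεη (k : ℕ) : ε k ≤ η := div_le_self hη.le (one_le_pow₀ (by linarith))
  obtain ⟨w, y, hw, hwy, hy⟩ := exists_gliding_hump (hx := hx) hε fun k F =>
    let ⟨w, hwW, hwF, hw⟩ := hD (ε k) (hε k) F
    ⟨w, hwF, And.intro hwW hw⟩
  refine ⟨w, y, fun k => (hw k).1, hy, ⟨η, hη, fun k => ?_⟩, ⟨κ * (η + D), fun k j => ?_⟩,
    fun m j => ?_, fun m j hj => ?_⟩
  · have h_one : 1 ≤ κ * (η + ‖y k i‖) := by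
      calc 1 = ‖w k i - y k i + y k i‖ := by rw [sub_add_cancel, (hw k).2.1]
        _ ≤ κ * (‖w k i - y k i‖ + ‖y k i‖) := hadd i _ _
        _ ≤ κ * (η + ‖y k i‖) := by gcongr; exact (hwy k i).le.trans (hεη k)
    have h_two : 1 = κ * (η + η) := by simp only [η]; field_simp; ring
    rw [h_two] at h_one
    linarith [le_of_mul_le_mul_left h_one hκ0]
  · calc ‖y k j‖ = ‖y k j - w k j + w k j‖ := by rw [sub_add_cancel]
      _ ≤ κ * (‖y k j - w k j‖ + ‖w k j‖) := hadd j _ _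
      _ ≤ κ * (η + D) := by
        rw [norm_sub_comm 𝕜]
        gcongr
        · exact (hwy k j).le.trans (hεη k)
        · exact (hw k).2.2.2 j
  · rw [← Finset.sum_sub_distrib]
    exact (norm_sum_le_of_norm_le_geometric 𝕜 hκ (hadd j) hη.le
      (fun k => (hwy k j).le) m).trans hη_one
  · exact (norm_sum_le_of_norm_le_geometric 𝕜 hκ (hadd j) hη.le
      (fun k => (hw k).2.2.1 j hj) m).trans hη_one

theorem IsCriticalIndex.exists_seq_isLittleO_of_isTop [PartialOrder J] {i : J}
    (hi : IsCriticalIndex hx W i) (h_top : IsTop i) :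
    ∃ w : ℕ → ∀ j, X j, (∀ m, w m ∈ W) ∧ (∀ᶠ m in atTop, w m i ≠ 0) ∧
      ∀ j ≠ i, (fun m => ‖w m j‖) =o[atTop] fun m => ‖w m i‖ := by
  obtain ⟨D, hD⟩ := hi
  choose w hwW _ hw_one hw_lt _ using fun m : ℕ =>
    hD (1 / ((m : ℝ) + 1)) Nat.one_div_pos_of_nat ∅
  refine ⟨w, hwW, Eventually.of_forall fun m h0 => ?_, fun j hj => ?_⟩
  · simpa [h0, norm_zero 𝕜] using hw_one m
  · simp only [hw_one, isLittleO_one_iff]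
    exact squeeze_zero (fun m => norm_nonneg 𝕜 _) (fun m => hw_lt m j ((h_top j).lt_of_ne hj))
      tendsto_one_div_add_atTop_nhds_zero_nat

theorem IsCriticalIndex.exists_seq_isLittleO_of_dominates [LinearOrder J] [Finite J] {i j₀ : J}
    (hi : IsCriticalIndex hx W i) (hj₀ : i < j₀) (hdom : ∀ j, i < j → (hx i).Dominates (hx j)) :
    ∃ w : ℕ → ∀ j, X j, (∀ m, w m ∈ W) ∧ (∀ᶠ m in atTop, w m i ≠ 0) ∧
      ∀ j ≠ i, (fun m => ‖w m j‖) =o[atTop] fun m => ‖w m i‖ := by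
  obtain ⟨w, y, hwW, hy, ⟨c, hc, hcy⟩, ⟨D, hyD⟩, hwy, hw_low⟩ := hi.exists_disjointlySupported
  let S (j : J) (m : ℕ) : ℝ := ‖∑ k ∈ Finset.range m, w k j‖
  let T (j : J) (m : ℕ) : ℝ := ‖∑ k ∈ Finset.range m, y k j‖
  have hST (j : J) : S j =O[atTop] fun m => 1 + T j m :=
    isBigO_one_add_norm_of_norm_sub_le 𝕜 fun m => hwy m j
  have hTS : T i =O[atTop] fun m => 1 + S i m :=
    isBigO_one_add_norm_of_norm_sub_le 𝕜 fun m => (norm_sub_comm 𝕜 _ _).trans_le (hwy m i)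
  have h_one_T : (fun _ => (1 : ℝ)) =o[atTop] T i :=
    (hdom j₀ hj₀).one_isLittleO_norm_sum (hy i) hc hcy
  have hTS' : T i =O[atTop] S i := hTS.trans <| by
    simpa using (h_one_T.trans_isBigO hTS).right_isBigO_sub
  refine ⟨fun m => ∑ k ∈ Finset.range m, w k, fun m => W.sum_mem fun k _ => hwW k, ?_,
    fun j hj => ?_⟩
  · filter_upwards [(h_one_T.trans_isBigO hTS').isBigO.eq_zero_imp] with m hm h0
    refine one_ne_zero (hm ?_)
    simp only [S, ← Finset.sum_apply, h0, norm_zero 𝕜]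
  · simp only [Finset.sum_apply]
    suffices h : S j =o[atTop] T i from h.trans_isBigO hTS'
    rcases hj.lt_or_gt with hj | hj
    · refine IsBigO.trans_isLittleO (IsBigO.of_bound 1 (Eventually.of_forall fun m => ?_)) h_one_T
      simpa [S, abs_of_nonneg (norm_nonneg 𝕜 _)] using hw_low m j hj
    · exact (hST j).trans_isLittleO <| h_one_T.add <|
        (hdom j hj).norm_sum_isLittleO_norm_sum (hy i) (hy j) hc hcy fun k => hyD k j

theorem exists_seq_isLittleO_component [LinearOrder J] [Finite J]
    (hdom : ∀ i j, i < j → (hx i).Dominates (hx j)) (hW : ¬ FiniteDimensional 𝕜 W) :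
    ∃ (i : J) (w : ℕ → ∀ j, X j), (∀ m, w m ∈ W) ∧ (∀ᶠ m in atTop, w m i ≠ 0) ∧
      ∀ j ≠ i, (fun m => ‖w m j‖) =o[atTop] fun m => ‖w m i‖ := by
  obtain ⟨i, hi⟩ := exists_isCriticalIndex hx hW
  refine ⟨i, ?_⟩
  by_cases h_top : IsTop i
  · exact hi.exists_seq_isLittleO_of_isTop h_top
  · obtain ⟨j₀, hj₀⟩ := not_forall.1 h_top
    exact hi.exists_seq_isLittleO_of_dominates (not_le.1 hj₀) (hdom i)

theorem exists_seq_concentrating [LinearOrder J] [Finite J]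
    (hdom : ∀ i j, i < j → (hx i).Dominates (hx j)) (hW : ¬ FiniteDimensional 𝕜 W) :
    ∃ (i : J) (w : ℕ → ∀ j, X j), (∀ m, w m ∈ W) ∧
      ¬ Tendsto (fun m => w m i) atTop (𝓝 0) ∧
      ∀ j ≠ i, Tendsto (fun m => w m j) atTop (𝓝 0) := by
  obtain ⟨i, w, hwW, hw_ne, hw_lt⟩ := exists_seq_isLittleO_component hdom hW
  refine ⟨i, fun m => ((‖w m i‖⁻¹ : ℝ) : 𝕜) • w m, fun m => W.smul_mem _ (hwW m), ?_,
    fun j hj => ?_⟩ <;>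
  simp only [tendsto_nhds_iff 𝕜, sub_zero, Pi.smul_apply, norm_inv_norm_smul]
  · refine fun h => one_ne_zero (tendsto_nhds_unique (tendsto_const_nhds.congr' ?_) h)
    filter_upwards [hw_ne] with m hm
    rw [div_self (norm_pos 𝕜 hm).ne']
  · exact (hw_lt j hj).tendsto_div_nhds_zero

theorem finiteDimensional_of_continuousLinearEquiv [LinearOrder J] [Finite J]
    (hdom : ∀ i j, i < j → (hx i).Dominates (hx j)) {A B : Set J} (hAB : Disjoint A B)
    {M : Submodule 𝕜 ((j : A) → X j)} {N : Submodule 𝕜 ((j : B) → X j)} (e : M ≃L[𝕜] N) :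
    FiniteDimensional 𝕜 M := by
  classical
  by_contra hM
  let L : M →L[𝕜] ∀ j, X j := ContinuousLinearMap.pi fun j =>
    if hj : j ∈ A then (ContinuousLinearMap.proj (⟨j, hj⟩ : A)).comp M.subtypeL
    else if hj : j ∈ B then
      ((ContinuousLinearMap.proj (⟨j, hj⟩ : B)).comp N.subtypeL).comp (e : M →L[𝕜] N)
    else 0
  have hLA (z : M) (j : A) : L z j = z.1 j := by simp [L]
  have hLB (z : M) (j : B) : L z j = (e z).1 j := by
    simp [L, hAB.notMem_of_mem_right j.2]
  have hL : Function.Injective L := fun z z' h =>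
    Subtype.ext <| funext fun j => by rw [← hLA, h, hLA]
  have hW : ¬ FiniteDimensional 𝕜 (LinearMap.range (L : M →ₗ[𝕜] ∀ j, X j)) := fun h =>
    hM (LinearEquiv.ofInjective (L : M →ₗ[𝕜] ∀ j, X j) hL).symm.finiteDimensional
  obtain ⟨i, w, hwW, hwi, hw⟩ := exists_seq_concentrating hdom hW
  choose z hz using hwW
  obtain rfl : (fun m => L (z m)) = w := funext hz
  suffices h : Tendsto z atTop (𝓝 0) by
    refine hwi (tendsto_pi_nhds.1 (?_ : Tendsto (fun m => L (z m)) atTop (𝓝 0)) i)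
    exact (L.continuous.tendsto' 0 0 (map_zero L)).comp h
  by_cases hi : i ∈ A
  · have hez : Tendsto (fun m => e (z m)) atTop (𝓝 0) :=
      tendsto_subtype_rng.2 <| tendsto_pi_nhds.2 fun j => by
        simpa [hLB] using hw j (hAB.ne_of_mem hi j.2).symm
    simpa [Function.comp_def] using (e.symm.continuous.tendsto 0).comp hez
  · exact tendsto_subtype_rng.2 <| tendsto_pi_nhds.2 fun j => by
      simpa [hLA] using hw j fun h => hi (h ▸ j.2)

end DirectSum

theorem lt_of_forall_succ {n : ℕ} {q r : Fin n → ℝ≥0∞}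
    (hqr : ∀ j k : Fin n, (j : ℕ) + 1 = k → q j < r k)
    (hrq : ∀ j : Fin n, 0 < (j : ℕ) → (j : ℕ) + 1 < n → r j ≤ q j) {i j : Fin n} (hij : i < j) :
    q i < r j := by
  obtain ⟨j, hj⟩ := j
  replace hij : (i : ℕ) + 1 ≤ j := hij
  induction j, hij using Nat.le_induction with
  | base => exact hqr _ _ rfl
  | succ k hk ih =>
    have hkn : k < n := (Nat.lt_succ_self k).trans hj
    calc q i < r ⟨k, hkn⟩ := ih hkn
      _ ≤ q ⟨k, hkn⟩ := hrq _ (Nat.zero_lt_of_lt hk) hj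
      _ < r ⟨k + 1, hj⟩ := hqr _ _ rfl

theorem dominates_of_lt {𝕜 : Type*} [RCLike 𝕜] {n : ℕ} {X : Fin n → Type*}
    [∀ j, AddCommGroup (X j)] [∀ j, Module 𝕜 (X j)] [∀ j, Norm (X j)]
    [∀ j, TopologicalSpace (X j)] [∀ j, QuasiNormedSpace 𝕜 (X j)]
    {ι : Fin n → Type*} {x : (j : Fin n) → ι j → X j}
    {hx : ∀ j, IsUnconditionalBasis 𝕜 (x j)} {q r : Fin n → ℝ≥0∞}
    (hq_pos : ∀ j : Fin n, (j : ℕ) + 1 < n → 0 < q j)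
    (hqr : ∀ j k : Fin n, (j : ℕ) + 1 = k → q j < r k)
    (h_lower : ∀ j : Fin n, (j : ℕ) + 1 < n → (hx j).LowerEstimate (q j))
    (h_upper : ∀ j : Fin n, 0 < (j : ℕ) → (hx j).UpperEstimate (r j))
    (h_mid : ∀ j : Fin n, 0 < (j : ℕ) → (j : ℕ) + 1 < n →
      ¬ FiniteDimensional 𝕜 (X j) ∨ r j ≤ q j) {i j : Fin n} (hij : i < j) :
    (hx i).Dominates (hx j) := by
  have hrq (k : Fin n) (hk : 0 < (k : ℕ)) (hkn : (k : ℕ) + 1 < n) : r k ≤ q k := by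
    refine (h_mid k hk hkn).elim (fun hX => ?_) id
    by_contra! hlt
    exact (hx k).not_dominates_self hX ⟨_, _, hq_pos k hkn, hlt, h_lower k hkn, h_upper k hk⟩
  have hi : (i : ℕ) + 1 < n := (Nat.succ_le_of_lt hij).trans_lt j.2
  exact ⟨q i, r j, hq_pos i hi, lt_of_forall_succ hqr hrq hij, h_lower i hi,
    h_upper j (Nat.zero_lt_of_lt hij)⟩

theorem proposition4p7_general {𝕜 : Type*} [RCLike 𝕜] {n : ℕ} {X : Fin n → Type*}
    [∀ j, AddCommGroup (X j)] [∀ j, Module 𝕜 (X j)] [∀ j, Norm (X j)]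
    [∀ j, TopologicalSpace (X j)] [∀ j, QuasiNormedSpace 𝕜 (X j)]
    {ι : Fin n → Type*} {x : (j : Fin n) → ι j → X j}
    (hx : ∀ j, IsUnconditionalBasis 𝕜 (x j))
    (q r : Fin n → ℝ≥0∞)
    (hq_pos : ∀ j : Fin n, (j : ℕ) + 1 < n → 0 < q j)
    (hqr : ∀ j k : Fin n, (j : ℕ) + 1 = k → q j < r k)
    (h_lower : ∀ j : Fin n, (j : ℕ) + 1 < n → (hx j).LowerEstimate (q j))
    (h_upper : ∀ j : Fin n, 0 < (j : ℕ) → (hx j).UpperEstimate (r j))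
    (h_mid : ∀ j : Fin n, 0 < (j : ℕ) → (j : ℕ) + 1 < n →
      ¬ FiniteDimensional 𝕜 (X j) ∨ r j ≤ q j)
    {A B : Set (Fin n)} (hAB : Disjoint A B)
    {M : Submodule 𝕜 ((j : A) → X j)} {N : Submodule 𝕜 ((j : B) → X j)} (e : M ≃L[𝕜] N) :
    FiniteDimensional 𝕜 M :=
  finiteDimensional_of_continuousLinearEquiv
    (fun _ _ hij => dominates_of_lt hq_pos hqr h_lower h_upper h_mid hij) hAB e

/-- The spaces `X_1, …, X_n` are indexed by `Fin n`, so `X_j` has index `j - 1`. The direct sum over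
a set of indices is the finite product, whose topology is that of the maximum of the quasi-norms. -/
theorem proposition4p7 {𝕜 : Type*} [RCLike 𝕜] {n : ℕ} {X : Fin n → Type u}
    [∀ j, AddCommGroup (X j)] [∀ j, Module 𝕜 (X j)] [∀ j, Norm (X j)] [∀ j, UniformSpace (X j)]
    [∀ j, QuasiBanachSpace 𝕜 (X j)]
    {ι : Fin n → Type v} {x : (j : Fin n) → ι j → X j}
    (hx : ∀ j, IsUnconditionalBasis 𝕜 (x j))
    (q r : Fin n → ℝ≥0∞)
    (hq_pos : ∀ j : Fin n, (j : ℕ) + 1 < n → 0 < q j)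
    (hr_pos : ∀ j : Fin n, 0 < (j : ℕ) → 0 < r j)
    (hqr : ∀ j k : Fin n, (j : ℕ) + 1 = k → q j < r k)
    (h_lower : ∀ j : Fin n, (j : ℕ) + 1 < n → (hx j).LowerEstimate (q j))
    (h_upper : ∀ j : Fin n, 0 < (j : ℕ) → (hx j).UpperEstimate (r j))
    (h_mid : ∀ j : Fin n, 0 < (j : ℕ) → (j : ℕ) + 1 < n →
      ¬ FiniteDimensional 𝕜 (X j) ∨ r j ≤ q j)
    (A B : Set (Fin n)) (hAB : IsCompl A B) :
    TotallyIncomparable.{w} 𝕜 ((j : A) → X j) ((j : B) → X j) :=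
  fun ⟨_, _, _, _, _, _, hZ, ⟨_, ⟨e⟩⟩, ⟨_, ⟨f⟩⟩⟩ =>
    have := proposition4p7_general hx q r hq_pos hqr h_lower h_upper h_mid hAB.disjoint
      (e.symm.trans f)
    hZ e.symm.finiteDimensional
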